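/- For an integer $n \ge 1$, let $\mathcal{L}_n$ denote the set of Littlewood polynomials of degree $n$, that is, polynomials $f(z) = a_0 + a_1 z + \dots + a_n z^n \in \mathbb{Z}[z]$ with $a_j \in \{-1, 1\}$ for every $0 \le j \le n$. For such $f$, let $N(f)$ be the number of complex zeros of $f$ in the open unit disk $\{|z| < 1\}$ and $U(f)$ the number of complex zeros of $f$ on the unit circle $\{|z| = 1\}$, both counted with multiplicity. A pair $(k, n)$ of integers with $1 \le k \le n - 1$ is called Littlewood-admissible if there exists $f \in \mathcal{L}_n$ with $U(f) = 0$ and $N(f) = k$. **Theorem.** Let $k$ and $n$ be integers with $3 \le k \le 11$ and $n \ge k + 3$. Then both pairs $(k, n)$ and $(n - k, n)$ are Littlewood-admissible. -/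

import Mathlib

open Polynomial

/-- `f ∈ ℤ[z]` is a Littlewood polynomial of degree `n`: its degree is `n` and all of its
coefficients `a_0, ..., a_n` belong to `{-1, 1}`. -/
def IsLittlewood (n : ℕ) (f : ℤ[X]) : Prop :=
  f.natDegree = n ∧ ∀ j ≤ n, f.coeff j = 1 ∨ f.coeff j = -1

open Classical in
/-- `N(f)`: the number of complex zeros of `f` in the open unit disk, with multiplicity. -/
noncomputable def numZerosInDisk (f : ℤ[X]) : ℕ :=
  (f.map (Int.castRingHom ℂ)).roots.countP (fun z => ‖z‖ < 1)

open Classical in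
/-- `U(f)`: the number of complex zeros of `f` on the unit circle, with multiplicity. -/
noncomputable def numZerosOnCircle (f : ℤ[X]) : ℕ :=
  (f.map (Int.castRingHom ℂ)).roots.countP (fun z => ‖z‖ = 1)

/-- The pair `(k, n)` is Littlewood-admissible: it is a valid pair, i.e. `1 ≤ k ≤ n - 1`, and
some Littlewood polynomial of degree `n` has exactly `k` zeros in the open unit disk and
none on the unit circle. -/
def LittlewoodAdmissible (k n : ℕ) : Prop :=
  (1 ≤ k ∧ k + 1 ≤ n) ∧
    ∃ f : ℤ[X], IsLittlewood n f ∧ numZerosOnCircle f = 0 ∧ numZerosInDisk f = k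

/-! Fix a head `p` with m coefficients ±1 and fill up with ones: f = p + z^m + ... + z^n. Then (1 -
z) f = q - z^(n+1), where q = (1 - z) p + z^m does not depend on n. If |q| > 1 on the unit circle
except at z = 1, then f/q = (1 - z^(n+1)/q) · 1/(1 - z) is a product of two numbers of positive real
part, so it avoids the negative axis; at z = 1 it equals f(1), which must be positive. Rouché's
theorem then gives N(f) = N(q), so one head settles all large n for a given k.

What remains is finite: N(q) is computed by the Schur–Cohn algorithm, and |q| > 1 follows from an
approximate sum-of-squares certificate in integers. For even k the heads start at n = k + 4, and n =
k + 3 gets its own polynomial. Reversing coefficients turns k into n - k. -/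

/-! ### Argument principle and Rouché's theorem -/

theorem circleIntegral_sub_inv_eq_zero {w : ℂ} (hw : 1 < ‖w‖) :
    (∮ z in C(0, 1), (z - w)⁻¹) = 0 := by
  refine Complex.circleIntegral_eq_zero_of_differentiable_on_off_countable zero_le_one
    Set.countable_empty (fun z hz => ?_) fun z hz => ?_
  · have : z - w ≠ 0 := fun h => by
      rw [sub_eq_zero.1 h, mem_closedBall_zero_iff] at hz; linarith
    exact (((continuousAt_id).sub continuousAt_const).inv₀ this).continuousWithinAt
  · have : z - w ≠ 0 := fun h => by
      have hz := hz.1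
      rw [sub_eq_zero.1 h, mem_ball_zero_iff] at hz; linarith
    exact (differentiableAt_id.sub_const w).inv this

open Classical in
theorem circleIntegral_sum_sub_inv (s : Multiset ℂ) (hs : ∀ r ∈ s, ‖r‖ ≠ 1) :
    CircleIntegrable (fun z => (s.map fun r => (z - r)⁻¹).sum) 0 1 ∧
      (∮ z in C(0, 1), (s.map fun r => (z - r)⁻¹).sum) =
        2 * Real.pi * Complex.I * (s.countP fun z => ‖z‖ < 1 : ℕ) := by
  induction s using Multiset.induction with
  | empty => simp [circleIntegral]
  | cons r s ih =>
    obtain ⟨hi, hv⟩ := ih fun x hx => hs x (Multiset.mem_cons_of_mem hx)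
    have hr : ‖r‖ ≠ 1 := hs r (Multiset.mem_cons_self r s)
    have hri : CircleIntegrable (fun z => (z - r)⁻¹) 0 1 := by
      rw [circleIntegrable_sub_inv_iff]; right; simpa using hr
    simp only [Multiset.map_cons, Multiset.sum_cons]
    refine ⟨hri.add hi, ?_⟩
    rw [circleIntegral.integral_add hri hi, hv]
    by_cases h : ‖r‖ < 1
    · rw [Multiset.countP_cons_of_pos (p := fun z : ℂ => ‖z‖ < 1) s h,
        circleIntegral.integral_sub_inv_of_mem_ball (by simpa using h)]
      push_cast; ring
    · rw [Multiset.countP_cons_of_neg (p := fun z : ℂ => ‖z‖ < 1) s h, circleIntegral_sub_inv_eq_zero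
        (lt_of_le_of_ne (not_lt.1 h) hr.symm), zero_add]

theorem aeval_int_eq_eval_map (f : ℤ[X]) (z : ℂ) :
    aeval z f = (f.map (Int.castRingHom ℂ)).eval z := by
  rw [aeval_def, eval_map, algebraMap_int_eq]

theorem circleIntegral_logDeriv_eq_numZerosInDisk (f : ℤ[X])
    (hf : ∀ z : ℂ, ‖z‖ = 1 → aeval z f ≠ 0) :
    CircleIntegrable (fun z => aeval z (derivative f) / aeval z f) 0 1 ∧
      (∮ z in C(0, 1), aeval z (derivative f) / aeval z f) =
        2 * Real.pi * Complex.I * numZerosInDisk f := by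
  set p := f.map (Int.castRingHom ℂ) with hp
  have hs : ∀ r ∈ p.roots, ‖r‖ ≠ 1 := fun r hr h => by
    apply hf r h
    rw [aeval_int_eq_eval_map]
    exact isRoot_of_mem_roots hr
  obtain ⟨hi, hv⟩ := circleIntegral_sum_sub_inv p.roots hs
  have heq : Set.EqOn (fun z : ℂ => aeval z (derivative f) / aeval z f)
      (fun z => (p.roots.map fun r => (z - r)⁻¹).sum) (Metric.sphere 0 1) := fun z hz => by
    have hz : ‖z‖ = 1 := by simpa using hz
    have h0 : p.eval z ≠ 0 := by rw [hp, ← aeval_int_eq_eval_map]; exact hf z hz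
    have := (IsAlgClosed.splits p).eval_derivative_div_eval_of_ne_zero h0
    simp only [aeval_int_eq_eval_map, ← derivative_map]
    simpa only [one_div] using this
  refine ⟨(circleIntegrable_congr (by simpa using heq)).2 hi, ?_⟩
  rw [circleIntegral.integral_congr zero_le_one heq, hv]
  rfl

/-- **Rouché's theorem** for polynomials on the unit disk. -/
theorem numZerosInDisk_eq_of_div_mem_slitPlane {f g : ℤ[X]}
    (h : ∀ z : ℂ, ‖z‖ = 1 → aeval z f / aeval z g ∈ Complex.slitPlane) :
    numZerosInDisk f = numZerosInDisk g := by
  have hf : ∀ z : ℂ, ‖z‖ = 1 → aeval z f ≠ 0 := fun z hz h0 => by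
    simpa [h0] using h z hz
  have hg : ∀ z : ℂ, ‖z‖ = 1 → aeval z g ≠ 0 := fun z hz h0 => by
    simpa [h0] using h z hz
  obtain ⟨hfi, hfv⟩ := circleIntegral_logDeriv_eq_numZerosInDisk f hf
  obtain ⟨hgi, hgv⟩ := circleIntegral_logDeriv_eq_numZerosInDisk g hg
  -- On the whole circle the difference of logarithmic derivatives has the primitive log(f/g), so
  -- its integral vanishes.
  have key : (∮ z in C(0, 1), (aeval z (derivative f) / aeval z f -
      aeval z (derivative g) / aeval z g : ℂ)) = 0 := by
    refine circleIntegral.integral_eq_zero_of_hasDerivWithinAt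
      (f := fun z => Complex.log (aeval z f / aeval z g)) zero_le_one fun z hz => ?_
    have hz : ‖z‖ = 1 := by simpa using hz
    have := (((f.hasDerivAt_aeval z).div (g.hasDerivAt_aeval z) (hg z hz)).clog
      (h z hz)).hasDerivWithinAt (s := Metric.sphere 0 1)
    refine this.congr_deriv ?_
    have := hf z hz
    have := hg z hz
    simp only [Pi.div_apply]
    field_simp
  rw [circleIntegral.integral_sub hfi hgi, hfv, hgv, ← mul_sub, mul_eq_zero] at key
  rcases key with key | key
  · exact absurd key Complex.two_pi_I_ne_zero
  · exact_mod_cast sub_eq_zero.1 key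

theorem numZerosOnCircle_eq_zero {f : ℤ[X]} (hf : ∀ z : ℂ, ‖z‖ = 1 → aeval z f ≠ 0) :
    numZerosOnCircle f = 0 := by
  classical
  unfold numZerosOnCircle
  rw [Multiset.countP_eq_zero]
  intro z hz h
  apply hf z h
  rw [aeval_int_eq_eval_map]
  exact isRoot_of_mem_roots hz

theorem numZerosInDisk_mul {f g : ℤ[X]} (hf : f ≠ 0) (hg : g ≠ 0) :
    numZerosInDisk (f * g) = numZerosInDisk f + numZerosInDisk g := by
  classical
  have hinj : Function.Injective (Int.castRingHom ℂ) := Int.cast_injective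
  unfold numZerosInDisk
  rw [Polynomial.map_mul, roots_mul, Multiset.countP_add]
  exact mul_ne_zero ((Polynomial.map_ne_zero_iff hinj).2 hf)
    ((Polynomial.map_ne_zero_iff hinj).2 hg)

theorem numZerosInDisk_C (a : ℤ) : numZerosInDisk (C a) = 0 := by
  have : ((a : ℂ[X])).roots = 0 := by rw [← C_eq_intCast]; exact roots_C _
  simp [numZerosInDisk, this]

theorem numZerosInDisk_X : numZerosInDisk X = 1 := by
  classical
  simp [numZerosInDisk, Multiset.countP_eq_card_filter, Multiset.filter_singleton]

theorem numZerosInDisk_X_add_C {a : ℤ} (ha : 1 ≤ |a|) : numZerosInDisk (X + C a) = 0 := by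
  classical
  have h : (X + C a : ℤ[X]).map (Int.castRingHom ℂ) = X - C (-(a : ℂ)) := by simp
  have ha' : (1 : ℝ) ≤ ‖(a : ℂ)‖ := by
    rw [Complex.norm_intCast]; exact_mod_cast ha
  simp only [numZerosInDisk, h, roots_X_sub_C, Multiset.countP_eq_zero, Multiset.mem_singleton,
    not_lt]
  rintro z rfl
  simpa using ha'

/-! ### Reversal of coefficients -/

/-- The roots of the reverse polynomial are the inverses of the roots. -/
theorem roots_reverse {p : ℂ[X]} (hp : p.coeff 0 ≠ 0) :
    p.reverse.roots = p.roots.map fun r => r⁻¹ := by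
  have key : ∀ s : Multiset ℂ, (0 : ℂ) ∉ s →
      ((s.map fun r => X - C r).prod.reverse).roots = s.map fun r => r⁻¹ := by
    intro s
    induction s using Multiset.induction with
    | empty => intro _; rw [Multiset.map_zero, Multiset.prod_zero, ← C_1, reverse_C, roots_C]; rfl
    | cons r s ih =>
      intro h0
      have hr : r ≠ 0 := fun h => h0 (h ▸ Multiset.mem_cons_self r s)
      have ih := ih fun h => h0 (Multiset.mem_cons_of_mem h)
      have hlin : (X - C r : ℂ[X]).reverse = C (-r) * (X - C r⁻¹) := by
        have : (X - C r : ℂ[X]).reverse = 1 - C r * X := by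
          have hX : (X : ℂ[X]).reverse = 1 := by
            rw [← one_mul (X : ℂ[X]), reverse_mul_X, ← C_1, reverse_C]
          rw [sub_eq_add_neg, ← C_neg, reverse_add_C, hX, natDegree_X, C_neg]; ring
        rw [this, mul_sub, ← C_mul, neg_mul, mul_inv_cancel₀ hr]
        simp; ring
      have hs : (s.map fun r => X - C r).prod.reverse ≠ (0 : ℂ[X]) := by
        rw [Ne, reverse_eq_zero]
        exact (monic_multiset_prod_of_monic _ _ fun r _ => monic_X_sub_C r).ne_zero
      rw [Multiset.map_cons, Multiset.prod_cons, Multiset.map_cons, reverse_mul_of_domain,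
        roots_mul (mul_ne_zero (by simp [hlin, hr, X_sub_C_ne_zero]) hs), ih, hlin,
        roots_C_mul _ (neg_ne_zero.2 hr), roots_X_sub_C, Multiset.singleton_add]
  have hp0 : p ≠ 0 := fun h => hp (by simp [h])
  have hlc : p.leadingCoeff ≠ 0 := leadingCoeff_ne_zero.2 hp0
  conv_lhs => rw [(IsAlgClosed.splits p).eq_prod_roots]
  rw [reverse_mul_of_domain, reverse_C, roots_C_mul _ hlc, key]
  intro h
  exact hp (by rw [coeff_zero_eq_eval_zero]; exact isRoot_of_mem_roots h)

theorem IsLittlewood.reverse {n : ℕ} {f : ℤ[X]} (hf : IsLittlewood n f) :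
    IsLittlewood n f.reverse := by
  have h0 : f.coeff 0 ≠ 0 := by rcases hf.2 0 n.zero_le with h | h <;> simp [h]
  refine ⟨by rw [reverse_natDegree, natTrailingDegree_eq_zero.2 (Or.inr h0), hf.1,
    Nat.sub_zero], fun j hj => ?_⟩
  rw [coeff_reverse, hf.1, revAt_le hj]
  exact hf.2 _ (Nat.sub_le n j)

/-- Reversal inverts the zeros; with none on the circle, the n - k outer ones become the inner ones.
-/
theorem LittlewoodAdmissible.symm {k n : ℕ} (h : LittlewoodAdmissible k n) :
    LittlewoodAdmissible (n - k) n := by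
  classical
  obtain ⟨⟨h1, h2⟩, f, hf, hU, hN⟩ := h
  refine ⟨⟨by omega, by omega⟩, f.reverse, hf.reverse, ?_⟩
  have hinj : Function.Injective (Int.castRingHom ℂ) := Int.cast_injective
  set p := f.map (Int.castRingHom ℂ) with hp
  have hrev : f.reverse.map (Int.castRingHom ℂ) = p.reverse := by
    rw [Polynomial.reverse, Polynomial.reverse, reflect_map, natDegree_map_eq_of_injective hinj]
  have h0 : p.coeff 0 ≠ 0 := by
    rcases hf.2 0 n.zero_le with h | h <;> simp [hp, h]
  have hroots : (f.reverse.map (Int.castRingHom ℂ)).roots = p.roots.map fun r => r⁻¹ := by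
    rw [hrev, roots_reverse h0]
  have hz : ∀ r ∈ p.roots, r ≠ 0 := fun r hr h => h0 (by
    rw [coeff_zero_eq_eval_zero]; subst h; exact isRoot_of_mem_roots hr)
  have hU' : ∀ r ∈ p.roots, ‖r‖ ≠ 1 := Multiset.countP_eq_zero.1 hU
  have hcard : Multiset.card p.roots = n := by
    rw [IsAlgClosed.card_roots_eq_natDegree, hp, natDegree_map_eq_of_injective hinj, hf.1]
  constructor
  · unfold numZerosOnCircle
    rw [hroots, Multiset.countP_eq_zero]
    intro z hz' h
    obtain ⟨r, hr, rfl⟩ := Multiset.mem_map.1 hz'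
    exact hU' r hr (by simpa using h)
  · have hsum := Multiset.card_eq_countP_add_countP (fun z : ℂ => ‖z‖ < 1) p.roots
    have : numZerosInDisk f.reverse = p.roots.countP fun z => ¬ ‖z‖ < 1 := by
      unfold numZerosInDisk
      rw [hroots, Multiset.countP_map, ← Multiset.countP_eq_card_filter]
      refine Multiset.countP_congr rfl fun r hr => ?_
      rw [norm_inv, inv_lt_one₀ (norm_pos_iff.2 (hz r hr)), not_lt, eq_iff_iff]
      exact ⟨le_of_lt, fun h => lt_of_le_of_ne h (hU' r hr).symm⟩
    have hN : p.roots.countP (fun z => ‖z‖ < 1) = k := hN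
    omega

/-! ### Computable coefficient lists and the Schur–Cohn algorithm -/

/-- The polynomial with the given list of coefficients, constant term first. -/
noncomputable def ofList : List ℤ → ℤ[X]
  | [] => 0
  | a :: l => C a + X * ofList l

namespace CoeffList

/-- Coefficient list of a sum of polynomials. -/
def add : List ℤ → List ℤ → List ℤ
  | [], m => m
  | l, [] => l
  | a :: l, b :: m => (a + b) :: add l m

/-- Coefficient list of a constant multiple of a polynomial. -/
def smul (c : ℤ) (l : List ℤ) : List ℤ := l.map fun x => c * x

/-- Coefficient list of a product of polynomials. -/
def mul : List ℤ → List ℤ → List ℤ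
  | [], _ => []
  | a :: l, m => add (smul a m) (0 :: mul l m)

/-- Coefficient list of the monomial `c * X ^ n`. -/
def monomial (n : ℕ) (c : ℤ) : List ℤ := List.replicate n 0 ++ [c]

/-- Application of a function to a natural number, evaluating the argument first. -/
def forceNat {α : Type*} : ℕ → (ℕ → α) → α
  | 0, f => f 0
  | n + 1, f => f (n + 1)

/-- Application of a function to an integer, evaluating the argument first. -/
def forceInt {α : Type*} : ℤ → (ℤ → α) → α
  | .ofNat n, f => forceNat n fun n => f (.ofNat n)
  | .negSucc n, f => forceNat n fun n => f (.negSucc n)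

/-- Application of a function to a list of integers, evaluating the entries first. -/
def forceList {α : Type*} : List ℤ → (List ℤ → α) → α
  | [], f => f []
  | a :: l, f => forceInt a fun a => forceList l fun l => f (a :: l)

theorem forceNat_eq {α : Type*} (n : ℕ) (f : ℕ → α) : forceNat n f = f n := by
  cases n <;> rfl

theorem forceInt_eq {α : Type*} (n : ℤ) (f : ℤ → α) : forceInt n f = f n := by
  cases n <;> simp [forceInt, forceNat_eq]

theorem forceList_eq {α : Type*} (l : List ℤ) (f : List ℤ → α) : forceList l f = f l := by
  induction l generalizing f with
  | nil => rfl
  | cons a l ih => rw [forceList, forceInt_eq, ih]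

/-- The Schur–Cohn algorithm: the number of zeros in the open unit disk of the polynomial with
the given coefficients, if the algorithm succeeds in at most `n` steps. -/
def schurCohn : ℕ → List ℤ → Option ℕ
  | 0, _ => none
  | _, [] => none
  | _ + 1, [a] => if a = 0 then none else some 0
  | n + 1, a :: b :: l =>
    let p := a :: b :: l
    let c := p.getLastD 0
    if c.natAbs < a.natAbs then
      let q := add (smul a p) (smul (-c) p.reverse)
      if q = q.dropLast ++ [0] then forceList q.dropLast fun q => schurCohn n q else none
    else if a.natAbs < c.natAbs then
      -- Here the constant term cancels; the factor X split off accounts for the extra zero.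
      let q := add (smul c p) (smul (-a) p.reverse)
      if q = 0 :: q.tail then (forceList q.tail fun q => schurCohn n q).map (· + 1) else none
    else none

end CoeffList

open CoeffList

@[simp] theorem ofList_nil : ofList [] = 0 := rfl

@[simp] theorem ofList_cons (a : ℤ) (l : List ℤ) : ofList (a :: l) = C a + X * ofList l := rfl

theorem ofList_append (l m : List ℤ) : ofList (l ++ m) = ofList l + X ^ l.length * ofList m := by
  induction l with
  | nil => simp
  | cons a l ih => simp only [List.cons_append, ofList_cons, ih, List.length_cons]; ring

theorem ofList_add (l m : List ℤ) : ofList (add l m) = ofList l + ofList m := by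
  fun_induction add l m with
  | case1 => simp
  | case2 => simp
  | case3 a l b m ih => simp only [ofList_cons, ih, C_add]; ring

theorem ofList_smul (c : ℤ) (l : List ℤ) : ofList (smul c l) = C c * ofList l := by
  induction l with
  | nil => simp [smul]
  | cons a l ih =>
    change C (c * a) + X * ofList (smul c l) = _
    rw [ih, ofList_cons, C_mul]; ring

theorem ofList_mul (l m : List ℤ) : ofList (mul l m) = ofList l * ofList m := by
  induction l with
  | nil => simp [mul]
  | cons a l ih =>
    simp only [mul, ofList_add, ofList_smul, ofList_cons, ih, C_0]; ring

theorem ofList_replicate_zero (n : ℕ) : ofList (List.replicate n 0) = 0 := by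
  induction n with
  | zero => rfl
  | succ n ih => simp [List.replicate_succ, ih]

theorem ofList_monomial (n : ℕ) (c : ℤ) : ofList (CoeffList.monomial n c) = C c * X ^ n := by
  rw [CoeffList.monomial, ofList_append, ofList_replicate_zero]
  simp [mul_comm]

theorem ofList_replicate_one_mul (t : ℕ) :
    (1 - X) * ofList (List.replicate t 1) = 1 - X ^ t := by
  induction t with
  | zero => simp
  | succ t ih =>
    rw [List.replicate_succ, ofList_cons, mul_add, mul_left_comm, ih, C_1]; ring

theorem coeff_ofList (l : List ℤ) (j : ℕ) : (ofList l).coeff j = l.getD j 0 := by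
  induction l generalizing j with
  | nil => simp
  | cons a l ih => cases j with
    | zero => simp
    | succ j => rw [ofList_cons, coeff_add, coeff_C_succ, coeff_X_mul, ih]; simp

theorem isLittlewood_ofList {l : List ℤ} {n : ℕ} (hn : l.length = n + 1)
    (hl : ∀ a ∈ l, a = 1 ∨ a = -1) : IsLittlewood n (ofList l) := by
  have hc : ∀ j ≤ n, (ofList l).coeff j = 1 ∨ (ofList l).coeff j = -1 := fun j hj => by
    have hj : j < l.length := by omega
    rw [coeff_ofList, List.getD_eq_getElem _ _ hj]
    exact hl _ (List.getElem_mem hj)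
  refine ⟨le_antisymm ?_ (le_natDegree_of_ne_zero ?_), hc⟩
  · rw [natDegree_le_iff_coeff_eq_zero]
    intro N hN
    rw [coeff_ofList, List.getD_eq_default _ _ (by omega)]
  · rcases hc n le_rfl with h | h <;> simp [h]

theorem aeval_one_ofList (l : List ℤ) : aeval (1 : ℂ) (ofList l) = (l.sum : ℤ) := by
  induction l with
  | nil => simp
  | cons a l ih => simp [ih]

theorem norm_aeval_ofList_le (l : List ℤ) {z : ℂ} (hz : ‖z‖ = 1) :
    ‖aeval z (ofList l)‖ ≤ ((l.map fun a => |a|).sum : ℤ) := by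
  induction l with
  | nil => simp
  | cons a l ih =>
    simp only [ofList_cons, map_add, map_mul, aeval_X, List.map_cons, List.sum_cons,
      Int.cast_add, Int.cast_abs]
    refine (norm_add_le _ _).trans (add_le_add ?_ ?_)
    · simp
    · rwa [norm_mul, hz, one_mul]

/-- On the circle the conjugate of z is 1/z. The factor z on the left avoids the exponent `l.length
- 1`. -/
theorem mul_aeval_ofList_reverse (l : List ℤ) {z : ℂ} (hz : ‖z‖ = 1) :
    z * aeval z (ofList l.reverse) = z ^ l.length * starRingEnd ℂ (aeval z (ofList l)) := by
  have hz' : z * starRingEnd ℂ z = 1 := by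
    rw [Complex.mul_conj, Complex.normSq_eq_norm_sq, hz]; simp
  induction l with
  | nil => simp
  | cons a l ih =>
    simp only [List.reverse_cons, ofList_append, ofList_cons, ofList_nil, map_add, map_mul,
      map_pow, aeval_X, mul_zero, add_zero, List.length_reverse, List.length_cons, mul_add, ih]
    have ha : starRingEnd ℂ (aeval z (C a)) = aeval z (C a) := by simp
    rw [ha]
    linear_combination (-z ^ l.length * starRingEnd ℂ (aeval z (ofList l))) * hz'

theorem norm_aeval_ofList_reverse (l : List ℤ) {z : ℂ} (hz : ‖z‖ = 1) :
    ‖aeval z (ofList l.reverse)‖ = ‖aeval z (ofList l)‖ := by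
  have := congrArg norm (mul_aeval_ofList_reverse l hz)
  simpa [hz] using this

/-- One step of the Schur–Cohn algorithm. -/
theorem numZerosInDisk_schurTransform (l : List ℤ) {a c : ℤ} (hac : c.natAbs < a.natAbs)
    (h : ∀ z : ℂ, ‖z‖ = 1 → aeval z (ofList (add (smul a l) (smul (-c) l.reverse))) ≠ 0) :
    (∀ z : ℂ, ‖z‖ = 1 → aeval z (ofList l) ≠ 0) ∧
      numZerosInDisk (ofList l) =
        numZerosInDisk (ofList (add (smul a l) (smul (-c) l.reverse))) := by
  have hac' : ‖(c : ℂ)‖ < ‖(a : ℂ)‖ := by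
    rw [Complex.norm_intCast, Complex.norm_intCast, ← Int.cast_abs, ← Int.cast_abs, Int.cast_lt,
      Int.abs_eq_natAbs, Int.abs_eq_natAbs]
    exact_mod_cast hac
  have ha : (a : ℂ) ≠ 0 := norm_pos_iff.1 ((norm_nonneg _).trans_lt hac')
  have hev : ∀ z : ℂ, aeval z (ofList (add (smul a l) (smul (-c) l.reverse))) =
      a * aeval z (ofList l) - c * aeval z (ofList l.reverse) := fun z => by
    simp [ofList_add, ofList_smul, sub_eq_add_neg]
  have hne : ∀ z : ℂ, ‖z‖ = 1 → aeval z (ofList l) ≠ 0 := fun z hz h0 => by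
    refine h z hz ?_
    have h1 := norm_aeval_ofList_reverse l hz
    rw [h0, norm_zero, norm_eq_zero] at h1
    rw [hev, h0, h1]; simp
  refine ⟨hne, ?_⟩
  have hl : ofList l ≠ 0 := fun h0 => hne 1 norm_one (by rw [h0, map_zero])
  have hCa : C a ≠ (0 : ℤ[X]) := by
    rw [Ne, C_eq_zero]; rintro rfl; simp at ha
  -- A polynomial and its reversal have equal modulus on the circle, so the term with `a` dominates.
  have hrouche : numZerosInDisk (ofList (add (smul a l) (smul (-c) l.reverse))) =
      numZerosInDisk (C a * ofList l) := by
    refine numZerosInDisk_eq_of_div_mem_slitPlane fun z hz => ?_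
    have hp := hne z hz
    have heq : aeval z (ofList (add (smul a l) (smul (-c) l.reverse))) / aeval z (C a * ofList l) =
        1 + (-(c * aeval z (ofList l.reverse)) / (a * aeval z (ofList l))) := by
      rw [hev]
      rw [map_mul, aeval_C, algebraMap_int_eq, eq_intCast]
      field_simp
      ring
    rw [heq]
    refine Complex.mem_slitPlane_of_norm_lt_one ?_
    rw [norm_div, norm_neg, norm_mul, norm_mul, norm_aeval_ofList_reverse l hz,
      mul_div_mul_right _ _ (norm_ne_zero_iff.2 hp),
      div_lt_one (norm_pos_iff.2 ha)]
    exact hac'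
  rw [hrouche, numZerosInDisk_mul hCa hl, numZerosInDisk_C, zero_add]

theorem numZerosInDisk_of_schurCohn {n k : ℕ} {l : List ℤ} (h : schurCohn n l = some k) :
    (∀ z : ℂ, ‖z‖ = 1 → aeval z (ofList l) ≠ 0) ∧ numZerosInDisk (ofList l) = k := by
  induction n generalizing l k with
  | zero => simp [schurCohn] at h
  | succ n ih =>
    match l with
    | [] => simp [schurCohn] at h
    | [a] =>
      rw [schurCohn] at h
      split_ifs at h with ha
      obtain rfl : 0 = k := Option.some.inj h
      simp only [ofList_cons, ofList_nil, mul_zero, add_zero, numZerosInDisk_C, and_true]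
      intro z _
      simpa using ha
    | a :: b :: l =>
      rw [schurCohn] at h
      set p := a :: b :: l
      set c := p.getLastD 0
      simp only [forceList_eq] at h
      split_ifs at h with h1 h2 h3 h4
      · set q := add (smul a p) (smul (-c) p.reverse) with hq
        obtain ⟨i1, i2⟩ := ih h
        have he : ofList q = ofList q.dropLast := by
          conv_lhs => rw [h2]
          rw [ofList_append]; simp
        rw [← he] at i1 i2
        obtain ⟨j1, j2⟩ := numZerosInDisk_schurTransform p h1 i1
        exact ⟨j1, j2.trans i2⟩
      · set q := add (smul c p) (smul (-a) p.reverse) with hq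
        obtain ⟨k', hk', rfl⟩ := Option.map_eq_some_iff.1 h
        obtain ⟨i1, i2⟩ := ih hk'
        have he : ofList q = X * ofList q.tail := by
          conv_lhs => rw [h4]
          simp
        have i1' : ∀ z : ℂ, ‖z‖ = 1 → aeval z (ofList q) ≠ 0 := fun z hz => by
          rw [he, map_mul, aeval_X]
          exact mul_ne_zero (fun h0 => by simp [h0] at hz) (i1 z hz)
        have ht : ofList q.tail ≠ 0 := fun h0 => i1 1 norm_one (by rw [h0, map_zero])
        obtain ⟨j1, j2⟩ := numZerosInDisk_schurTransform p h3 i1'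
        refine ⟨j1, j2.trans ?_⟩
        rw [← hq, he, numZerosInDisk_mul X_ne_zero ht, numZerosInDisk_X, i2, add_comm]

/-! ### Heads followed by ones -/

namespace CoeffList

/-- The coefficients of `(1 - X) * p + X ^ m`, where `p` has the `m` coefficients `l`. -/
def tailNumerator (l : List ℤ) : List ℤ := add (l ++ [1]) (0 :: smul (-1) l)

/-- With `q` the polynomial with coefficients `tailNumerator l` and `m` the length of `l`, the
lists `S` and `G` and the integers `K` and `c` certify that on the unit circle
`K * (‖q z‖ ^ 2 - 1) = ‖1 - z‖ ^ 2 * (‖g z‖ ^ 2 + c + r z)` with `‖r z‖ < c`. -/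
def IsTailCertificate (l S G : List ℤ) (K c : ℤ) : Prop :=
  (0 < K ∧ l ≠ [] ∧ (tailNumerator l).length = l.length + 1 ∧ G.length = l.length) ∧
  add (mul (tailNumerator l) (tailNumerator l).reverse) (monomial l.length (-1)) =
    mul [-1, 2, -1] S ∧
  ((add (smul K S) (add (smul (-1) (mul G G.reverse)) (monomial (l.length - 1) (-c)))).map
    fun a => |a|).sum < c

instance (l S G : List ℤ) (K c : ℤ) : Decidable (IsTailCertificate l S G K c) :=
  inferInstanceAs (Decidable (_ ∧ _ ∧ _))

end CoeffList

theorem ofList_tailNumerator (l : List ℤ) :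
    ofList (tailNumerator l) = (1 - X) * ofList l + X ^ l.length := by
  simp only [tailNumerator, ofList_add, ofList_append, ofList_cons, ofList_smul, ofList_nil, C_0,
    C_1, C_neg]
  ring

/-- On the circle -(1 - z)^2 = z |1 - z|^2, and a polynomial times its reversal is its squared
modulus times a power of z. So `S` represents (|q|^2 - 1) / |1 - z|^2, and `K * S` is |g|^2 + c up
to an error whose coefficients have absolute sum below `c`. -/
theorem CoeffList.IsTailCertificate.one_lt_norm {l S G : List ℤ} {K c : ℤ}
    (h : IsTailCertificate l S G K c) {z : ℂ} (hz : ‖z‖ = 1) (hz1 : z ≠ 1) :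
    1 < ‖aeval z (ofList (tailNumerator l))‖ := by
  obtain ⟨⟨hK, hl, hq, hG⟩, hS, hc⟩ := h
  obtain ⟨e, he⟩ : ∃ e, l.length = e + 1 :=
    Nat.exists_eq_succ_of_ne_zero (by simpa using hl)
  rw [he] at hq hG hS hc
  have hz0 : z ≠ 0 := fun h0 => by simp [h0] at hz
  have hzz : z * starRingEnd ℂ z = 1 := by
    rw [Complex.mul_conj, Complex.normSq_eq_norm_sq, hz]; simp
  set R := add (smul K S) (add (smul (-1) (mul G G.reverse))
    (CoeffList.monomial (e + 1 - 1) (-c))) with hR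
  set q := aeval z (ofList (tailNumerator l))
  set g := aeval z (ofList G)
  set s := aeval z (ofList S)
  set w := aeval z (ofList R)
  have hqr := mul_aeval_ofList_reverse (tailNumerator l) hz
  have hgr := mul_aeval_ofList_reverse G hz
  have h1 := congrArg (fun L => aeval z (ofList L)) hS
  have h2 : w = _ := congrArg (fun L => aeval z (ofList L)) hR
  simp only [ofList_add, ofList_mul, ofList_smul, ofList_monomial, ofList_cons, ofList_nil,
    map_add, map_mul, map_pow, aeval_X, aeval_C, map_neg, map_one, map_ofNat, mul_zero, add_zero,
    Nat.add_sub_cancel] at h1 h2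
  simp only [algebraMap_int_eq, eq_intCast] at h2
  rw [hq] at hqr
  rw [hG] at hgr
  have hqq := Complex.mul_conj' q
  have hgg := Complex.mul_conj' g
  have hdd := Complex.mul_conj' (1 - z)
  rw [map_sub, map_one] at hdd
  have key : (((K : ℝ) * (‖q‖ ^ 2 - 1) - ‖1 - z‖ ^ 2 * (‖g‖ ^ 2 + c) : ℝ) : ℂ) * z ^ e =
      (‖1 - z‖ : ℂ) ^ 2 * w := by
    push_cast
    apply mul_left_cancel₀ (pow_ne_zero 2 hz0)
    have hq2 : q * aeval z (ofList (tailNumerator l).reverse) * z =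
        z ^ (e + 2) * (‖q‖ : ℂ) ^ 2 := by linear_combination q * hqr + z ^ (e + 2) * hqq
    have hg2 : z * (g * aeval z (ofList G.reverse)) = z ^ (e + 1) * (‖g‖ : ℂ) ^ 2 := by
      linear_combination g * hgr + z ^ (e + 1) * hgg
    have hd2 : z * (‖1 - z‖ : ℂ) ^ 2 = -(1 - z) ^ 2 := by
      linear_combination -z * hdd - (1 - z) * hzz
    linear_combination -(z ^ 2 * (‖1 - z‖ : ℂ) ^ 2) * h2 + z * (‖1 - z‖ : ℂ) ^ 2 * hg2
      - K * hq2 + K * z * h1 - K * z * s * hd2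
  have hw : ‖w‖ < c := lt_of_le_of_lt (norm_aeval_ofList_le R hz) (by exact_mod_cast hc)
  have hd : 0 < ‖1 - z‖ ^ 2 := pow_pos (norm_pos_iff.2 (sub_ne_zero.2 hz1.symm)) 2
  have hn := congrArg norm key
  rw [norm_mul, norm_pow, hz, one_pow, mul_one, norm_mul, norm_pow, Complex.norm_real,
    Complex.norm_real, norm_norm, Real.norm_eq_abs] at hn
  have h3 := neg_abs_le ((K : ℝ) * (‖q‖ ^ 2 - 1) - ‖1 - z‖ ^ 2 * (‖g‖ ^ 2 + c))
  rw [hn] at h3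
  have hpos : 0 < (K : ℝ) * (‖q‖ ^ 2 - 1) := by
    nlinarith [mul_lt_mul_of_pos_left hw hd, mul_nonneg hd.le (sq_nonneg ‖g‖)]
  have hK' : (0 : ℝ) < K := by exact_mod_cast hK
  have := pos_of_mul_pos_right hpos hK'.le
  nlinarith [norm_nonneg q]

/-- If ab = x were real and nonpositive, then |a|^2 Re b = x Re a ≤ 0. -/
theorem mul_mem_slitPlane {a b : ℂ} (ha : 0 < a.re) (hb : 0 < b.re) :
    a * b ∈ Complex.slitPlane := by
  rw [Complex.mem_slitPlane_iff, Complex.mul_re, Complex.mul_im]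
  by_contra! h
  obtain ⟨h1, h2⟩ := h
  have : 0 < b.re * (a.re ^ 2 + a.im ^ 2) := by positivity
  nlinarith [mul_nonpos_of_nonneg_of_nonpos ha.le h1, congrArg (fun x => a.im * x) h2]

theorem littlewoodAdmissible_of_tailCertificate {l S G : List ℤ} {K c : ℤ} {k n : ℕ}
    (h : IsTailCertificate l S G K c) (hl : ∀ a ∈ l, a = 1 ∨ a = -1)
    (hk : schurCohn (l.length + 1) (tailNumerator l) = some k)
    (hk1 : 1 ≤ k) (hkn : k + 1 ≤ n) (hn : l.length ≤ n + 1)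
    (hs : 0 < l.sum + (n + 1 - l.length)) : LittlewoodAdmissible k n := by
  obtain ⟨t, ht⟩ := Nat.exists_eq_add_of_le hn
  set L := l ++ List.replicate t 1 with hL
  have hlen : L.length = n + 1 := by simp [hL, ht]
  have hone : aeval (1 : ℂ) (ofList L) = ((l.sum + t : ℤ) : ℂ) := by
    rw [aeval_one_ofList]; simp [hL]
  have hst : 0 < l.sum + t := by omega
  have hmul : (1 - X) * ofList L = ofList (tailNumerator l) - X ^ (n + 1) := by
    rw [hL, ofList_append, ofList_tailNumerator, mul_add, mul_left_comm,
      ofList_replicate_one_mul, ht]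
    ring
  have hslit : ∀ z : ℂ, ‖z‖ = 1 →
      aeval z (ofList L) / aeval z (ofList (tailNumerator l)) ∈ Complex.slitPlane := by
    intro z hz
    -- At z = 1 the strict bound fails, since q(1) = 1; positivity of f(1) replaces it.
    by_cases hz1 : z = 1
    · subst hz1
      have : aeval (1 : ℂ) (ofList (tailNumerator l)) = 1 := by simp [ofList_tailNumerator]
      rw [this, hone, div_one]
      exact Complex.mem_slitPlane_iff.2 (Or.inl (by exact_mod_cast hst))
    · have hq := h.one_lt_norm hz hz1
      set q := aeval z (ofList (tailNumerator l))
      have hq0 : q ≠ 0 := norm_pos_iff.1 (zero_lt_one.trans hq)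
      have hz1' : 1 - z ≠ 0 := sub_ne_zero.2 (Ne.symm hz1)
      have hev : (1 - z) * aeval z (ofList L) = q - z ^ (n + 1) := by
        have := congrArg (aeval z) hmul
        simpa using this
      have heq : aeval z (ofList L) / q = (1 - z ^ (n + 1) / q) * (1 - z)⁻¹ := by
        field_simp
        rw [mul_comm, hev]
      rw [heq]
      refine mul_mem_slitPlane ?_ ?_
      · have : (z ^ (n + 1) / q).re < 1 := by
          refine (Complex.re_le_norm _).trans_lt ?_
          rw [norm_div, norm_pow, hz, one_pow, div_lt_one (by linarith)]
          exact hq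
        simpa using this
      · rw [Complex.inv_re]
        refine div_pos ?_ (Complex.normSq_pos.2 hz1')
        have hsq : z.re ^ 2 + z.im ^ 2 = 1 := by
          have := Complex.normSq_eq_norm_sq z
          rw [hz, Complex.normSq_apply] at this
          linarith
        have : z.re ≠ 1 := fun h1 => hz1 (Complex.ext h1 (by
          rw [h1] at hsq; simpa using hsq))
        have : z.re ≤ 1 := by nlinarith [sq_nonneg z.im]
        simp only [Complex.sub_re, Complex.one_re]
        exact sub_pos.2 (lt_of_le_of_ne this ‹_›)
  refine ⟨⟨hk1, hkn⟩, ofList L, isLittlewood_ofList hlen ?_, numZerosOnCircle_eq_zero ?_, ?_⟩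
  · intro a ha
    rcases List.mem_append.1 ha with ha | ha
    · exact hl a ha
    · exact Or.inl (List.eq_of_mem_replicate ha)
  · intro z hz h0
    simpa [h0] using hslit z hz
  · rw [numZerosInDisk_eq_of_div_mem_slitPlane hslit, (numZerosInDisk_of_schurCohn hk).2]

/-- The end coefficients of a Littlewood polynomial have equal modulus, which stops Schur–Cohn at
once. The factor X + 2 breaks the tie and adds no zero in the closed disk. -/
theorem littlewoodAdmissible_of_schurCohn {l : List ℤ} {k n : ℕ} (hk1 : 1 ≤ k) (hkn : k + 1 ≤ n)
    (hlen : l.length = n + 1) (hl : ∀ a ∈ l, a = 1 ∨ a = -1)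
    (hk : schurCohn (n + 2) (mul [2, 1] l) = some k) : LittlewoodAdmissible k n := by
  obtain ⟨h1, h2⟩ := numZerosInDisk_of_schurCohn hk
  have hfac : ofList [2, 1] = X + C 2 := by simp [add_comm]
  rw [ofList_mul, hfac] at h1 h2
  have hne : ∀ z : ℂ, ‖z‖ = 1 → aeval z (ofList l) ≠ 0 := fun z hz h0 =>
    h1 z hz (by rw [map_mul, h0, mul_zero])
  have hl0 : ofList l ≠ 0 := fun h0 => hne 1 norm_one (by rw [h0, map_zero])
  rw [numZerosInDisk_mul (X_add_C_ne_zero 2) hl0, numZerosInDisk_X_add_C (by norm_num),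
    zero_add] at h2
  exact ⟨⟨hk1, hkn⟩, ofList l, isLittlewood_ofList hlen hl, numZerosOnCircle_eq_zero hne, h2⟩

/-! ### Explicit heads and conclusion -/

theorem littlewoodAdmissible_of_le {k n : ℕ} (hk3 : 3 ≤ k) (hk11 : k ≤ 11)
    (hn : k + 3 + (if Even k then 1 else 0) ≤ n) : LittlewoodAdmissible k n := by
  obtain ⟨l, S, G, K, c, h, hl, hk, hlen, hs⟩ : ∃ (l S G : List ℤ) (K c : ℤ),
      IsTailCertificate l S G K c ∧ (∀ a ∈ l, a = 1 ∨ a = -1) ∧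
      schurCohn (l.length + 1) (tailNumerator l) = some k ∧
      l.length ≤ k + 4 + (if Even k then 1 else 0) ∧
      0 < l.sum + ((k + 3 + (if Even k then 1 else 0) : ℕ) + 1 - l.length) := by
    -- For odd k the head alternates, with its last sign repeated, and has sum -2; f(1) > 0 then
    -- means n ≥ k + 3. For even k the sum, or for k = 8 the length, forces n ≥ k + 4.
    interval_cases k
    · exact ⟨[-1, 1, -1, -1], [2, 0, 0, 6, 0, 0, 2], [2, 0, 0, 1], 1, 1,
        by decide +kernel⟩
    · exact ⟨[1, -1, 1, -1, -1, -1], [-2, 0, -2, 2, 0, 8, 0, 2, -2, 0, -2], [3, 0, 1, -1, 0, -2],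
        3, 9,
        by decide +kernel⟩
    · exact ⟨[-1, 1, -1, 1, -1, -1], [2, 0, 0, 2, -2, 8, -2, 2, 0, 0, 2], [6, -2, 3, -1, 1, 3],
        10, 20,
        by decide +kernel⟩
    · exact ⟨[1, -1, 1, -1, 1, -1, -1, -1], [-2, 0, -2, 2, -4, 4, -2, 10, -2, 4, -4, 2, -2, 0,
        -2], [67, 2, 33, -38, 10, -12, 1, -24], 800, 153,
        by decide +kernel⟩
    · exact ⟨[-1, 1, -1, 1, -1, 1, -1, -1], [2, 0, 0, 2, -2, 4, -4, 10, -4, 4, -2, 2, 0, 0, 2],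
        [20, -7, 9, -6, 8, -3, 3, 8], 80, 88,
        by decide +kernel⟩
    · exact ⟨[1, -1, 1, -1, -1, -1, 1, -1, 1, 1, 1, 1, -1], [-2, 2, -2, 2, 2, 0, 0, -2, 0, -2, 2,
        -4, 12, -4, 2, -2, 0, -2, 0, 0, 2, 2, -2, 2, -2], [121, -51, 20, -17, 3,
        -31, 3, 5, 47, 17, -20, 19, -33], 2000, 717,
        by decide +kernel⟩
    · exact ⟨[-1, 1, -1, 1, -1, 1, -1, 1, -1, -1], [2, 0, 0, 2, -2, 4, -4, 6, -6, 12, -6, 6, -4,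
        4, -2, 2, 0, 0, 2], [47, -17, 21, -16, 21, -14, 18, -5, 6, 17], 400, 294,
        by decide +kernel⟩
    · exact ⟨[1, -1, -1, -1, 1, 1, 1, -1, -1, -1, 1, -1], [-2, 2, 0, 2, 0, 4, 0, 0, -6, 0, 2, 14,
        2, 0, -6, 0, 0, 4, 0, 2, 0, 2, -2], [255, 62, 24, -116, -32, 8, 123, 22, 30,
        -13, 78, -63], 8000, 1276,
        by decide +kernel⟩
    · exact ⟨[-1, 1, -1, 1, -1, 1, -1, 1, -1, 1, -1, -1], [2, 0, 0, 2, -2, 4, -4, 6, -6, 8, -8,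
        14, -8, 8, -6, 6, -4, 4, -2, 2, 0, 0, 2], [67, -25, 28, -25, 31, -23, 31,
        -19, 26, -7, 9, 24], 800, 483,
        by decide +kernel⟩
  exact littlewoodAdmissible_of_tailCertificate h hl hk (by omega) (by omega) (by omega) (by omega)

theorem littlewoodAdmissible_add_three {k : ℕ} (hk3 : 3 ≤ k) (hk11 : k ≤ 11) (hk : Even k) :
    LittlewoodAdmissible k (k + 3) := by
  refine littlewoodAdmissible_of_schurCohn (l := List.replicate k 1 ++ [-1, -1, 1, -1])
    (by omega) (by omega) (by simp) ?_ ?_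
  · intro a ha
    simp only [List.mem_append, List.mem_replicate, List.mem_cons, List.not_mem_nil,
      or_false] at ha
    rcases ha with ⟨-, ha⟩ | ha | ha | ha | ha <;> simp [ha]
  · interval_cases k <;> first | exact absurd hk (by decide) | decide +kernel

theorem theorem2p6 (k n : ℕ) (hk3 : 3 ≤ k) (hk11 : k ≤ 11) (hn : k + 3 ≤ n) :
    LittlewoodAdmissible k n ∧ LittlewoodAdmissible (n - k) n := by
  have h : LittlewoodAdmissible k n := by
    by_cases hk : Even k ∧ n = k + 3
    · rw [hk.2]
      exact littlewoodAdmissible_add_three hk3 hk11 hk.1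
    · refine littlewoodAdmissible_of_le hk3 hk11 ?_
      split_ifs with he
      · have : n ≠ k + 3 := fun h => hk ⟨he, h⟩
        omega
      · omega
  exact ⟨h, h.symm⟩
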